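/- Let $V$ be a finite-dimensional vector space over a field $K$, with dual $V^*$. A graph means a finite, connected, acyclic graph with every edge given a direction, and with vertices labeled by elements of $V^*$. Let $\mathrm{Gr}(V^*)$ be the $K$-vector space spanned by isomorphism classes of such labeled graphs, modulo multilinearity in the labels. In $\mathrm{Gr}(V^*)$ impose the following local relations, in which all vertices, all labels and all edges not shown are kept fixed: \[(a\to b)=-(b\to a)\quad\text{(arrow-reversing)},\] \[(a\to b\to c)+(b\to c\to a)+(c\to a\to b)=0\quad\text{(Arnold)}.\] Let $k\ge 0$, and let $G$ be a graph containing distinct vertices $z,y_1,\dots,y_k$ and the star of edges $z\to y_1,\dots,z\to y_k$; all its other edges are arbitrary. For $\sigma\in\Sigma_k$, let $G_\sigma$ be obtained from $G$ by replacing these $k$ edges by the long chain $y_{\sigma(1)}\to y_{\sigma(2)}\to\cdots\to y_{\sigma(k)}\to z$, all other edges, vertices and labels being unchanged. Then each $G_\sigma$ is again connected and acyclic, and modulo the arrow-reversing and Arnold relations \[G=(-1)^k\sum_{\sigma\in\Sigma_k}G_\sigma .\] If moreover all of $y_1,\dots,y_k$ carry the same label $x$, and in $G$ no $y_i$ meets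 any edge other than $z\to y_i$, then modulo these relations \[G=(-1)^k\,k!\;G_{\mathrm{id}} .\] -/

import Mathlib

/-- A set `E` of ordered pairs of elements of `X`, read as arrows `a ⟶ b` for `(a, b) ∈ E`, is an
oriented, connected, acyclic graph with vertex set `X`: two vertices are joined by at most one
arrow (and no vertex to itself), and the graph obtained by forgetting the directions is a tree. -/
def IsOrientedTree {X : Type} (E : Set (X × X)) : Prop :=
  (∀ a b : X, (a, b) ∈ E → (b, a) ∉ E) ∧
    (SimpleGraph.fromRel (fun a b : X => (a, b) ∈ E)).IsTree

/-- Finite, oriented, connected, acyclic graphs with vertices labeled by elements of `W`. -/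
structure LabeledGraph (W : Type*) where
  /-- the vertices -/
  Vert : Type
  finite_vert : Finite Vert
  /-- the arrows -/
  edges : Set (Vert × Vert)
  isOrientedTree : IsOrientedTree edges
  /-- the labels, not required to be distinct -/
  label : Vert → W

/-- Two labeled graphs are isomorphic if a bijection of their vertices respects arrows and
labels. -/
def LabeledGraph.IsIso {W : Type*} (γ δ : LabeledGraph W) : Prop :=
  ∃ e : γ.Vert ≃ δ.Vert, (∀ a b, (a, b) ∈ γ.edges ↔ (e a, e b) ∈ δ.edges) ∧
    ∀ v, δ.label (e v) = γ.label v

section Modules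

variable (K : Type*) [Field K] (W : Type*) [AddCommGroup W] [Module K W]

/-- The relations between formal linear combinations of labeled graphs that define `Gr K W`:
isomorphic graphs are equal, and a graph is multilinear in its labels. -/
inductive GrRel : (LabeledGraph W →₀ K) → Prop
  | iso (γ δ : LabeledGraph W) (h : γ.IsIso δ) :
      GrRel (Finsupp.single γ 1 - Finsupp.single δ 1)
  | add (X : Type) (hX : Finite X) (E : Set (X × X)) (hE : IsOrientedTree E)
      (l l₁ l₂ : X → W) (v : X) (hv : l v = l₁ v + l₂ v)
      (h : ∀ u, u ≠ v → l₁ u = l u ∧ l₂ u = l u) :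
      GrRel (Finsupp.single ⟨X, hX, E, hE, l⟩ 1
        - (Finsupp.single ⟨X, hX, E, hE, l₁⟩ 1 + Finsupp.single ⟨X, hX, E, hE, l₂⟩ 1))
  | smul (X : Type) (hX : Finite X) (E : Set (X × X)) (hE : IsOrientedTree E)
      (l l₁ : X → W) (v : X) (c : K) (hv : l v = c • l₁ v) (h : ∀ u, u ≠ v → l₁ u = l u) :
      GrRel (Finsupp.single ⟨X, hX, E, hE, l⟩ 1 - c • Finsupp.single ⟨X, hX, E, hE, l₁⟩ 1)

/-- The vector space generated by graphs with labels from `W`, modulo multilinearity in the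
labels. -/
abbrev Gr : Type _ := (LabeledGraph W →₀ K) ⧸ Submodule.span K {x | GrRel K W x}

variable {W}

/-- The class in `Gr K W` of a labeled graph. -/
noncomputable def Gr.of (γ : LabeledGraph W) : Gr K W :=
  Submodule.Quotient.mk (Finsupp.single γ 1)

variable (W)

/-- The arrow-reversing and Arnold expressions. `F` is the part of the graph that is kept fixed;
the requirement that each displayed set of arrows is an oriented tree forces the vertices `a`,
`b` (and `c`) to be distinct and no two of them to be joined by an arrow of `F`. -/
inductive LocalRel : Gr K W → Prop
  /-- `(a ⟶ b) + (b ⟶ a)` -/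
  | arrow (X : Type) (hX : Finite X) (l : X → W) (F : Set (X × X)) (a b : X)
      (h₁ : IsOrientedTree (F ∪ {(a, b)})) (h₂ : IsOrientedTree (F ∪ {(b, a)})) :
      LocalRel (Gr.of K ⟨X, hX, F ∪ {(a, b)}, h₁, l⟩ + Gr.of K ⟨X, hX, F ∪ {(b, a)}, h₂, l⟩)
  /-- `(a ⟶ b ⟶ c) + (b ⟶ c ⟶ a) + (c ⟶ a ⟶ b)` -/
  | arnold (X : Type) (hX : Finite X) (l : X → W) (F : Set (X × X)) (a b c : X)
      (h₁ : IsOrientedTree (F ∪ {(a, b), (b, c)}))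
      (h₂ : IsOrientedTree (F ∪ {(b, c), (c, a)}))
      (h₃ : IsOrientedTree (F ∪ {(c, a), (a, b)})) :
      LocalRel (Gr.of K ⟨X, hX, F ∪ {(a, b), (b, c)}, h₁, l⟩
        + Gr.of K ⟨X, hX, F ∪ {(b, c), (c, a)}, h₂, l⟩
        + Gr.of K ⟨X, hX, F ∪ {(c, a), (a, b)}, h₃, l⟩)

/-- `Gr K W` modulo the arrow-reversing and Arnold relations: the cofree conilpotent Lie
coalgebra on `W`, as a vector space. -/
abbrev LieCoalg : Type _ := Gr K W ⧸ Submodule.span K {x | LocalRel K W x}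

variable {W}

/-- The class modulo the arrow-reversing and Arnold relations of the graph with vertex set `X`,
arrows `E` and labels `l`. -/
noncomputable def graphClass {X : Type} [hX : Finite X] (l : X → W) (E : Set (X × X))
    (hE : IsOrientedTree E) : LieCoalg K W :=
  Submodule.Quotient.mk (Gr.of K ⟨X, hX, E, hE, l⟩)

end Modules

/-- The arrows `z ⟶ y i` of a star. -/
def starEdges {X : Type} {k : ℕ} (z : X) (y : Fin k → X) : Set (X × X) :=
  Set.range fun i : Fin k => (z, y i)

/-- The arrows of the long chain `y 0 ⟶ y 1 ⟶ ⋯ ⟶ y (k - 1) ⟶ z`. -/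
def chainEdges {X : Type} {k : ℕ} (y : Fin k → X) (z : X) : Set (X × X) :=
  Set.range fun i : Fin k =>
    (y i, if h : (i : ℕ) + 1 < k then y ⟨(i : ℕ) + 1, h⟩ else z)

/-! Modulo the relations, an arrow `z ⟶ w` attached to the end of a long chain into `z` can be
absorbed: Arnold on `c ⟶ z ⟶ w`, with `c` the last vertex before `z`, either inserts `w` between `c`
and `z` or moves the arrow back to `c`. Repeating this gives minus the sum over all insertions of
`w` into the chain (`treeClass_chain_add_arrow`). Absorbing the rays of the star one at a time
yields every ordering once, with one sign per ray (`treeClass_star`). A connected graph is a tree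
exactly when it has one edge fewer than vertices. The local moves preserve connectedness and the
number of arrows, so for `treeClass`, extended by zero, the relations hold without side conditions.
For equal labels on free leaves, permuting the leaves makes all `k!` chains isomorphic. -/

/-! ### Oriented trees by connectedness and counting -/

open SimpleGraph in
theorem SimpleGraph.Connected.of_fromRel {X : Type*} {R S : X → X → Prop}
    (hR : (fromRel R).Connected) (h : ∀ a b, R a b → (fromRel S).Reachable a b) :
    (fromRel S).Connected := by
  have key : ∀ a b, (fromRel R).Reachable a b → (fromRel S).Reachable a b := by
    rintro a b ⟨w⟩
    induction w with
    | nil => exact Reachable.refl _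
    | cons hab _ ih =>
      rcases (fromRel_adj _ _ _).1 hab with ⟨-, h' | h'⟩
      · exact (h _ _ h').trans ih
      · exact (h _ _ h').symm.trans ih
  have := hR.nonempty
  exact ⟨fun a b => key a b (hR.preconnected a b)⟩

theorem SimpleGraph.reachable_fromRel {X : Type*} {S : X → X → Prop} {a b : X} (h : S a b) :
    (SimpleGraph.fromRel S).Reachable a b := by
  by_cases hab : a = b
  · subst hab; exact SimpleGraph.Reachable.refl _
  · exact SimpleGraph.Adj.reachable ((SimpleGraph.fromRel_adj _ _ _).2 ⟨hab, Or.inl h⟩)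

/-- A multiset of arrows is an oriented tree precisely when it joins all vertices
and has one arrow less than there are vertices. -/
theorem isOrientedTree_and_nodup_iff {X : Type} [Finite X] (L : Multiset (X × X)) :
    (IsOrientedTree {e | e ∈ L} ∧ L.Nodup) ↔
      (SimpleGraph.fromRel fun a b : X => (a, b) ∈ L).Connected ∧ L.card + 1 = Nat.card X := by
  classical
  have := Fintype.ofFinite X
  set G := SimpleGraph.fromRel fun a b : X => (a, b) ∈ L with hG
  have hmem : ∀ s, s ∈ G.edgeSet → s ∈ L.map (fun e => s(e.1, e.2)) := by
    intro s
    induction s with | _ a b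
    intro h
    rw [SimpleGraph.mem_edgeSet, hG, SimpleGraph.fromRel_adj] at h
    rw [Multiset.mem_map]
    rcases h.2 with h | h
    · exact ⟨_, h, rfl⟩
    · exact ⟨_, h, Sym2.eq_swap⟩
  have hle : G.edgeFinset.val ≤ L.map (fun e => s(e.1, e.2)) :=
    (Multiset.le_iff_subset G.edgeFinset.nodup).2 fun s hs =>
      hmem s (SimpleGraph.mem_edgeFinset.1 hs)
  have hcard : Nat.card G.edgeSet = G.edgeFinset.val.card := by
    rw [Nat.card_eq_fintype_card, ← SimpleGraph.edgeFinset_card]; rfl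
  constructor
  · rintro ⟨⟨hanti, htree⟩, hnd⟩
    have htree : G.IsTree := htree
    rw [SimpleGraph.isTree_iff_connected_and_card] at htree
    refine ⟨htree.1, ?_⟩
    have hnd' : (L.map (fun e => s(e.1, e.2))).Nodup := by
      refine Multiset.Nodup.map_on ?_ hnd
      rintro ⟨a, b⟩ hab ⟨c, d⟩ hcd h
      rcases Sym2.eq_iff.1 h with ⟨h1, h2⟩ | ⟨h1, h2⟩
      · simp_all
      · simp only at h1 h2
        subst h1 h2
        exact absurd hcd (hanti _ _ hab)
    have hle' : L.map (fun e => s(e.1, e.2)) ≤ G.edgeFinset.val := by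
      refine (Multiset.le_iff_subset hnd').2 fun s hs => ?_
      obtain ⟨⟨a, b⟩, hab, rfl⟩ := Multiset.mem_map.1 hs
      refine SimpleGraph.mem_edgeFinset.2 ?_
      refine (SimpleGraph.fromRel_adj (fun a b : X => (a, b) ∈ L) _ _).2 ⟨?_, Or.inl hab⟩
      rintro h
      simp only at h
      subst h
      exact hanti _ _ hab hab
    have h := congrArg Multiset.card (le_antisymm hle hle')
    rw [Multiset.card_map] at h
    rw [← h, ← hcard, htree.2]
  · rintro ⟨hconn, hL⟩
    -- A connected graph has at least |X| - 1 edges, which is the size of `L`; hence forgetting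
    -- directions loses nothing, which excludes loops, repeated and opposite arrows.
    have h1 := hconn.card_vert_le_card_edgeSet_add_one
    have heq : G.edgeFinset.val = L.map (fun e => s(e.1, e.2)) :=
      Multiset.eq_of_le_of_card_le hle (by rw [Multiset.card_map]; omega)
    have hnd : (L.map (fun e => s(e.1, e.2))).Nodup := heq ▸ G.edgeFinset.nodup
    have hadj : ∀ a b, (a, b) ∈ L → G.Adj a b := fun a b h => by
      have : s(a, b) ∈ G.edgeFinset.val := heq ▸ Multiset.mem_map_of_mem (fun e => s(e.1, e.2)) h
      exact SimpleGraph.mem_edgeFinset.1 this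
    refine ⟨⟨fun a b hab hba => ?_, ?_⟩, hnd.of_map⟩
    · have h := Multiset.inj_on_of_nodup_map hnd _ hab _ hba Sym2.eq_swap
      exact (hadj a b hab).ne (Prod.ext_iff.1 h).1
    · change G.IsTree
      rw [SimpleGraph.isTree_iff_connected_and_card]
      refine ⟨hconn, ?_⟩
      rw [hcard, heq, Multiset.card_map, hL]

/-! ### Relations for multisets of arrows -/

section TreeClass

variable (K : Type*) [Field K] {W : Type*} [AddCommGroup W] [Module K W]

theorem graphClass_congr {X : Type} [Finite X] (l : X → W) {E E' : Set (X × X)} (h : E = E')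
    (hE : IsOrientedTree E) (hE' : IsOrientedTree E') :
    graphClass K l E hE = graphClass K l E' hE' := by
  subst h; rfl

theorem graphClass_eq_of_iso {X : Type} [Finite X] (l : X → W) {E E' : Set (X × X)}
    (hE : IsOrientedTree E) (hE' : IsOrientedTree E') (e : X ≃ X)
    (he : ∀ a b, (a, b) ∈ E ↔ (e a, e b) ∈ E') (hl : ∀ v, l (e v) = l v) :
    graphClass K l E hE = graphClass K l E' hE' := by
  unfold graphClass Gr.of
  congr 1
  rw [Submodule.Quotient.eq]
  exact Submodule.subset_span (GrRel.iso _ _ ⟨e, he, hl⟩)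

open Classical in
/-- The class of the graph with a multiset of arrows, zero if it is not an oriented tree or if an
arrow is repeated. -/
noncomputable def treeClass {X : Type} [Finite X] (l : X → W) (L : Multiset (X × X)) :
    LieCoalg K W :=
  if h : IsOrientedTree {e | e ∈ L} ∧ L.Nodup then graphClass K l _ h.1 else 0

variable {X : Type} [Finite X] (l : X → W)

theorem treeClass_of_nodup {L : Multiset (X × X)} {E : Set (X × X)} (hE : IsOrientedTree E)
    (hL : L.Nodup) (h : {e | e ∈ L} = E) : treeClass K l L = graphClass K l E hE := by
  subst h
  exact dif_pos ⟨hE, hL⟩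

theorem treeClass_eq_zero {L : Multiset (X × X)} (h : ¬(IsOrientedTree {e | e ∈ L} ∧ L.Nodup)) :
    treeClass K l L = 0 :=
  dif_neg h

/-- With the number of arrows unchanged, only connectedness has to be checked, and it suffices to
join the ends of each old arrow. -/
theorem isOrientedTree_and_nodup_of_reachable {L M : Multiset (X × X)}
    (hL : IsOrientedTree {e | e ∈ L} ∧ L.Nodup) (hc : M.card = L.card)
    (h : ∀ a b, (a, b) ∈ L → (SimpleGraph.fromRel fun a b : X => (a, b) ∈ M).Reachable a b) :
    IsOrientedTree {e | e ∈ M} ∧ M.Nodup := by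
  rw [isOrientedTree_and_nodup_iff] at hL ⊢
  exact ⟨hL.1.of_fromRel h, hc ▸ hL.2⟩

theorem isOrientedTree_and_nodup_swap {L : Multiset (X × X)} {a b : X}
    (h : IsOrientedTree {e | e ∈ (a, b) ::ₘ L} ∧ ((a, b) ::ₘ L).Nodup) :
    IsOrientedTree {e | e ∈ (b, a) ::ₘ L} ∧ ((b, a) ::ₘ L).Nodup := by
  refine isOrientedTree_and_nodup_of_reachable h (by simp) fun u v huv => ?_
  rcases Multiset.mem_cons.1 huv with huv | huv
  · obtain ⟨rfl, rfl⟩ := Prod.mk.inj huv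
    exact (SimpleGraph.reachable_fromRel (by simp)).symm
  · exact SimpleGraph.reachable_fromRel (by simp [huv])

theorem treeClass_swap (L : Multiset (X × X)) (a b : X) :
    treeClass K l ((a, b) ::ₘ L) = -treeClass K l ((b, a) ::ₘ L) := by
  by_cases h : IsOrientedTree {e | e ∈ (a, b) ::ₘ L} ∧ ((a, b) ::ₘ L).Nodup
  · have h' := isOrientedTree_and_nodup_swap h
    have key : ∀ a b : X, {e | e ∈ (a, b) ::ₘ L} = {e | e ∈ L} ∪ {(a, b)} := fun a b => by
      ext e; simp [or_comm]
    have h₁ := h.1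
    have h₂ := h'.1
    rw [key] at h₁ h₂
    rw [treeClass_of_nodup K l h₁ h.2 (key a b), treeClass_of_nodup K l h₂ h'.2 (key b a),
      eq_neg_iff_add_eq_zero]
    exact (Submodule.Quotient.mk_eq_zero _).2
      (Submodule.subset_span (LocalRel.arrow X ‹_› l {e | e ∈ L} a b h₁ h₂))
  · rw [treeClass_eq_zero K l h, treeClass_eq_zero K l (mt isOrientedTree_and_nodup_swap h),
      neg_zero]

theorem isOrientedTree_and_nodup_rotate {L : Multiset (X × X)} {a b c : X}
    (h : IsOrientedTree {e | e ∈ (a, b) ::ₘ (b, c) ::ₘ L} ∧ ((a, b) ::ₘ (b, c) ::ₘ L).Nodup) :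
    IsOrientedTree {e | e ∈ (b, c) ::ₘ (c, a) ::ₘ L} ∧ ((b, c) ::ₘ (c, a) ::ₘ L).Nodup := by
  refine isOrientedTree_and_nodup_of_reachable h (by simp) fun u v huv => ?_
  have hbc : (SimpleGraph.fromRel fun u v : X =>
      (u, v) ∈ (b, c) ::ₘ (c, a) ::ₘ L).Reachable b c :=
    SimpleGraph.reachable_fromRel (by simp)
  rcases Multiset.mem_cons.1 huv with huv | huv
  · obtain ⟨rfl, rfl⟩ := Prod.mk.inj huv
    exact (hbc.trans (SimpleGraph.reachable_fromRel (by simp))).symm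
  rcases Multiset.mem_cons.1 huv with huv | huv
  · obtain ⟨rfl, rfl⟩ := Prod.mk.inj huv
    exact hbc
  · exact SimpleGraph.reachable_fromRel (by simp [huv])

theorem treeClass_arnold (L : Multiset (X × X)) (a b c : X) :
    treeClass K l ((a, b) ::ₘ (b, c) ::ₘ L) + treeClass K l ((b, c) ::ₘ (c, a) ::ₘ L)
      + treeClass K l ((c, a) ::ₘ (a, b) ::ₘ L) = 0 := by
  by_cases h : IsOrientedTree {e | e ∈ (a, b) ::ₘ (b, c) ::ₘ L} ∧
      ((a, b) ::ₘ (b, c) ::ₘ L).Nodup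
  · have h' := isOrientedTree_and_nodup_rotate h
    have h'' := isOrientedTree_and_nodup_rotate h'
    have key : ∀ a b c : X, {e | e ∈ (a, b) ::ₘ (b, c) ::ₘ L} = {e | e ∈ L} ∪ {(a, b), (b, c)} :=
      fun a b c => by ext e; simp [or_comm]
    have h₁ := h.1
    have h₂ := h'.1
    have h₃ := h''.1
    rw [key] at h₁ h₂ h₃
    rw [treeClass_of_nodup K l h₁ h.2 (key a b c), treeClass_of_nodup K l h₂ h'.2 (key b c a),
      treeClass_of_nodup K l h₃ h''.2 (key c a b)]
    exact (Submodule.Quotient.mk_eq_zero _).2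
      (Submodule.subset_span (LocalRel.arnold X ‹_› l {e | e ∈ L} a b c h₁ h₂ h₃))
  -- Three rotations return to the start, so if one term is not a tree, none is, and all vanish.
  · rw [treeClass_eq_zero K l h, treeClass_eq_zero K l fun h' =>
      h (isOrientedTree_and_nodup_rotate (isOrientedTree_and_nodup_rotate h')),
      treeClass_eq_zero K l fun h' => h (isOrientedTree_and_nodup_rotate h')]
    simp

/-- The arrows of the chain that ends in `z` and whose other vertices are, going backwards from
`z`, those of a list. -/
def revChain {X : Type*} : X → List X → Multiset (X × X)
  | _, [] => 0
  | z, c :: cs => (c, z) ::ₘ revChain c cs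

@[simp] theorem revChain_nil {X : Type*} (z : X) : revChain z [] = 0 := rfl

@[simp] theorem revChain_cons {X : Type*} (z c : X) (cs : List X) :
    revChain z (c :: cs) = (c, z) ::ₘ revChain c cs := rfl

theorem card_revChain {X : Type*} (z : X) (cs : List X) :
    (revChain z cs).card = cs.length := by
  induction cs generalizing z with
  | nil => rfl
  | cons c cs ih => simp [ih]

/-- Induction along the chain, away from `z`. Keeping `L` arbitrary lets the arrow `c ⟶ z` already
passed join the fixed part. -/
theorem treeClass_chain_add_arrow (w : X) (cs : List X) (z : X) (L : Multiset (X × X)) :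
    treeClass K l ((z, w) ::ₘ (revChain z cs + L)) =
      -((List.permutations'Aux w cs).map fun p => treeClass K l (revChain z p + L)).sum := by
  induction cs generalizing z L with
  | nil => simpa using treeClass_swap K l L z w
  | cons c cs ih =>
    have h := treeClass_arnold K l (revChain c cs + L) c z w
    -- Two reversals cancel in sign and give `c ⟶ w ⟶ z`: the insertion of `w` next to `z`.
    have h₁ : treeClass K l ((z, w) ::ₘ (w, c) ::ₘ (revChain c cs + L)) =
        treeClass K l ((w, z) ::ₘ (c, w) ::ₘ (revChain c cs + L)) := by
      rw [treeClass_swap, Multiset.cons_swap, treeClass_swap, neg_neg, Multiset.cons_swap]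
    -- After one reversal, `c ⟶ w` hangs at the end of the shorter chain into `c`; induction gives
    -- the insertions of `w` further back.
    have h₂ : treeClass K l ((w, c) ::ₘ (c, z) ::ₘ (revChain c cs + L)) =
        ((List.permutations'Aux w cs).map fun p =>
          treeClass K l ((c, z) ::ₘ (revChain c p + L))).sum := by
      have := ih c ((c, z) ::ₘ L)
      simp only [Multiset.add_cons] at this
      rw [treeClass_swap, this, neg_neg]
    rw [h₁, h₂, Multiset.cons_swap] at h
    simp only [List.permutations'Aux, List.map_cons, List.sum_cons, List.map_map,
      Function.comp_def, revChain_cons, Multiset.cons_add]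
    rw [eq_neg_iff_add_eq_zero, ← h]
    abel

/-- `List.permutations'` is built by inserting the head into each permutation of the tail, which
matches absorbing one ray into the chains formed by the others. -/
theorem treeClass_star (z : X) (ys : List X) (L : Multiset (X × X)) :
    treeClass K l ((ys.map fun v => (z, v) : List (X × X)) + L) =
      (-1 : K) ^ ys.length •
        (ys.permutations'.map fun p => treeClass K l (revChain z p + L)).sum := by
  induction ys generalizing L with
  | nil => simp
  | cons w ys ih =>
    have h := ih ((z, w) ::ₘ L)
    rw [List.map_cons, ← Multiset.cons_coe, Multiset.cons_add, ← Multiset.add_cons, h]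
    have key : ∀ ps : List (List X),
        (ps.map fun p => treeClass K l (revChain z p + (z, w) ::ₘ L)).sum =
        -((ps.flatMap (List.permutations'Aux w)).map fun p =>
          treeClass K l (revChain z p + L)).sum := by
      intro ps
      induction ps with
      | nil => simp
      | cons p ps ih =>
        rw [List.map_cons, List.sum_cons, ih, Multiset.add_cons, treeClass_chain_add_arrow,
          List.flatMap_cons, List.map_append, List.sum_append, neg_add]
    rw [key, List.permutations', List.length_cons, pow_succ]
    simp

end TreeClass

/-! ### Lists versus families indexed by `Fin k` -/

theorem sum_permutations'_ofFn {X M : Type*} [AddCommMonoid M] {k : ℕ} {y : Fin k → X}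
    (hy : Function.Injective y) (f : List X → M) :
    ((List.ofFn y).permutations'.map f).sum =
      ∑ σ : Equiv.Perm (Fin k), f (List.ofFn fun i => y (σ i)) := by
  classical
  have hinj : Function.Injective fun σ : Equiv.Perm (Fin k) => List.ofFn fun i => y (σ i) :=
    fun σ τ h => Equiv.ext fun i => hy (congrFun (List.ofFn_injective h) i)
  have hnd : (List.ofFn y).permutations'.Nodup :=
    (List.permutations_perm_permutations' _).nodup_iff.1
      (List.nodup_permutations _ (List.nodup_ofFn.2 hy))
  have himg : Finset.univ.image (fun σ : Equiv.Perm (Fin k) => List.ofFn fun i => y (σ i)) =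
      (List.ofFn y).permutations'.toFinset := by
    -- One inclusion suffices, as both sides have `k!` elements by injectivity of `y`.
    refine Finset.eq_of_subset_of_card_le (fun p hp => ?_) ?_
    · obtain ⟨σ, -, rfl⟩ := Finset.mem_image.1 hp
      rw [List.mem_toFinset, List.mem_permutations']
      exact Equiv.Perm.ofFn_comp_perm σ y
    · rw [Finset.card_image_of_injective _ hinj, List.toFinset_card_of_nodup hnd,
        ← (List.permutations_perm_permutations' _).length_eq, List.length_permutations,
        List.length_ofFn, Finset.card_univ, Fintype.card_perm, Fintype.card_fin]
  rw [← List.sum_toFinset _ hnd, ← himg, Finset.sum_image fun _ _ _ _ h => hinj h]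

theorem List.reverse_ofFn {X : Type*} {k : ℕ} (f : Fin k → X) :
    (List.ofFn f).reverse = List.ofFn fun i => f i.rev := by
  refine List.ext_getElem (by simp) fun i h₁ h₂ => ?_
  simp only [List.length_ofFn, List.getElem_reverse, List.getElem_ofFn]
  exact congrArg f (Fin.ext (by simp only [Fin.val_rev]; omega))

theorem setOf_mem_revChain_ofFn {X : Type} {k : ℕ} (c : Fin k → X) (z : X) :
    {e | e ∈ revChain z (List.ofFn c).reverse} = chainEdges c z := by
  induction k generalizing z with
  | zero => ext e; simp [chainEdges]
  | succ k ih =>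
    have h : (List.ofFn c).reverse =
        c (Fin.last k) :: (List.ofFn fun i => c (Fin.castSucc i)).reverse := by
      rw [List.ofFn_succ_last, List.reverse_append]; rfl
    ext e
    have hlast : ∀ i : Fin k, (if h : (i : ℕ) + 1 < k + 1 then c ⟨i + 1, h⟩ else z) =
        if h : (i : ℕ) + 1 < k then c (Fin.castSucc ⟨i + 1, h⟩) else c (Fin.last k) := by
      intro i
      have hi := i.isLt
      rw [dif_pos (by omega)]
      split_ifs
      · rfl
      · exact congrArg c (Fin.ext (by simp only [Fin.val_last]; omega))
    have hi : e ∈ revChain (c (Fin.last k)) (List.ofFn fun i => c (Fin.castSucc i)).reverse ↔ _ :=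
      Set.ext_iff.1 (ih (fun i => c (Fin.castSucc i)) (c (Fin.last k))) e
    have hr : e ∈ chainEdges c z ↔ e = (c (Fin.last k), z) ∨
        e ∈ chainEdges (fun i => c (Fin.castSucc i)) (c (Fin.last k)) := by
      simp only [chainEdges, Set.mem_range, Fin.exists_fin_succ', Fin.val_castSucc, hlast,
        Fin.val_last, lt_irrefl, dite_false, eq_comm (a := e)]
      exact or_comm
    rw [hr, ← hi, h]
    exact Multiset.mem_cons

theorem reachable_of_mem_revChain {X : Type*} {S : X → X → Prop} {cs : List X} {z : X}
    (hS : ∀ a b, (a, b) ∈ revChain z cs → S a b) {v : X} (hv : v ∈ cs) :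
    (SimpleGraph.fromRel S).Reachable z v := by
  induction cs generalizing z with
  | nil => simp at hv
  | cons c cs ih =>
    have hc := (SimpleGraph.reachable_fromRel (hS c z (by simp))).symm
    rcases List.mem_cons.1 hv with rfl | hv
    · exact hc
    · exact hc.trans (ih (fun a b h => hS a b (by simp [h])) hv)

/-! ### The star as a sum of long chains -/

theorem propositionL {K : Type*} [Field K] {V : Type*} [AddCommGroup V] [Module K V]
    [FiniteDimensional K V] {X : Type} [Finite X] (l : X → Module.Dual K V)
    (k : ℕ) (z : X) (y : Fin k → X) (hy : Function.Injective y)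
    (F : Set (X × X)) (hF : ∀ i, (z, y i) ∉ F)
    (hstar : IsOrientedTree (F ∪ starEdges z y)) :
    ∃ hchain : ∀ σ : Equiv.Perm (Fin k), IsOrientedTree (F ∪ chainEdges (fun i => y (σ i)) z),
      graphClass K l (F ∪ starEdges z y) hstar =
        (-1 : K) ^ k • ∑ σ : Equiv.Perm (Fin k),
          graphClass K l (F ∪ chainEdges (fun i => y (σ i)) z) (hchain σ) ∧
      ((∃ x : Module.Dual K V, ∀ i, l (y i) = x) →
        (∀ e ∈ F, ∀ i, e.1 ≠ y i ∧ e.2 ≠ y i) →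
        graphClass K l (F ∪ starEdges z y) hstar =
          ((-1 : K) ^ k * (k.factorial : K)) •
            graphClass K l (F ∪ chainEdges y z) (hchain 1)) := by
  classical
  set L : Multiset (X × X) := F.toFinite.toFinset.val with hL
  have hmemL : ∀ e, e ∈ L ↔ e ∈ F := fun e => by simp [hL]
  set S : Multiset (X × X) := (((List.ofFn y).map fun v => (z, v) : List (X × X)) : Multiset (X × X)) with hS
  have hmemS : ∀ e, e ∈ S ↔ e ∈ starEdges z y := fun e => by simp [hS, starEdges]
  have hset : {e | e ∈ S + L} = F ∪ starEdges z y := by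
    ext e; simp [hmemL, hmemS, or_comm]
  have hnd : (S + L).Nodup := by
    refine (Multiset.nodup_add).2 ⟨?_, Finset.nodup _, ?_⟩
    · exact Multiset.coe_nodup.2
        ((List.nodup_ofFn.2 hy).map fun a b h => (Prod.mk.inj h).2)
    · refine Multiset.disjoint_left.2 fun {e} he he' => ?_
      obtain ⟨i, rfl⟩ := (hmemS e).1 he
      exact hF i ((hmemL _).1 he')
  have hchain' : ∀ σ : Equiv.Perm (Fin k),
      IsOrientedTree {e | e ∈ revChain z (List.ofFn fun i => y (σ i)).reverse + L} ∧
        (revChain z (List.ofFn fun i => y (σ i)).reverse + L).Nodup := by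
    intro σ
    refine isOrientedTree_and_nodup_of_reachable (L := S + L) ⟨hset ▸ hstar, hnd⟩
      (by simp [hS, card_revChain]) fun a b hab => ?_
    rcases Multiset.mem_add.1 hab with hab | hab
    · obtain ⟨i, hi⟩ := (hmemS _).1 hab
      obtain ⟨rfl, rfl⟩ := Prod.mk.inj hi
      refine reachable_of_mem_revChain (cs := (List.ofFn fun i => y (σ i)).reverse)
        (fun a b h => Multiset.mem_add.2 (Or.inl h)) ?_
      rw [List.mem_reverse, List.mem_ofFn]
      exact ⟨σ.symm i, by simp⟩
    · exact SimpleGraph.reachable_fromRel (Multiset.mem_add.2 (Or.inr hab))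
  have hcset : ∀ σ : Equiv.Perm (Fin k),
      {e | e ∈ revChain z (List.ofFn fun i => y (σ i)).reverse + L} =
        F ∪ chainEdges (fun i => y (σ i)) z := by
    intro σ
    rw [← setOf_mem_revChain_ofFn]
    ext e; simp [hmemL, or_comm]
  have hchain : ∀ σ : Equiv.Perm (Fin k), IsOrientedTree (F ∪ chainEdges (fun i => y (σ i)) z) :=
    fun σ => hcset σ ▸ (hchain' σ).1
  have hmain : graphClass K l (F ∪ starEdges z y) hstar =
      (-1 : K) ^ k • ∑ σ : Equiv.Perm (Fin k),
        graphClass K l (F ∪ chainEdges (fun i => y (σ i)) z) (hchain σ) := by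
    rw [← treeClass_of_nodup K l hstar hnd hset, treeClass_star, List.length_ofFn,
      sum_permutations'_ofFn hy]
    congr 1
    -- `revChain` reads the chain backwards from `z`, so the two sums match after composing `σ` with
    -- the reversal of `Fin k`.
    refine Fintype.sum_equiv (Equiv.mulRight Fin.revPerm) _ _ fun σ => ?_
    rw [← treeClass_of_nodup K l (hchain _) (hchain' _).2 (hcset _), List.reverse_ofFn]
    simp
  refine ⟨hchain, hmain, ?_⟩
  rintro ⟨x, hx⟩ hfree
  have hz : z ∉ Set.range y := by
    rintro ⟨i, hi⟩
    have h : (z, z) ∈ F ∪ starEdges z y := Or.inr ⟨i, congrArg (Prod.mk z) hi⟩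
    exact hstar.1 z z h h
  have hiso : ∀ σ : Equiv.Perm (Fin k),
      graphClass K l (F ∪ chainEdges (fun i => y (σ i)) z) (hchain σ) =
        graphClass K l (F ∪ chainEdges y z) (hchain 1) := by
    intro σ
    -- Extended by the identity off the `y i`, `σ` fixes `z` and all ends of arrows of `F`, and
    -- preserves labels; it carries the identity chain to the chain of `σ`.
    set e : Equiv.Perm X := σ.viaEmbedding ⟨y, hy⟩ with he
    have hey : ∀ i, e (y i) = y (σ i) := fun i => σ.viaEmbedding_apply ⟨y, hy⟩ i
    have hen : ∀ v, v ∉ Set.range y → e v = v := fun v hv =>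
      σ.viaEmbedding_apply_of_notMem ⟨y, hy⟩ v hv
    have himg : Prod.map e e '' (F ∪ chainEdges y z) =
        F ∪ chainEdges (fun i => y (σ i)) z := by
      rw [Set.image_union]
      congr 1
      · refine (Set.image_congr fun p hp => ?_).trans (Set.image_id' F)
        refine Prod.ext (hen _ ?_) (hen _ ?_)
        · rintro ⟨i, hi⟩
          exact (hfree p hp i).1 hi.symm
        · rintro ⟨i, hi⟩
          exact (hfree p hp i).2 hi.symm
      · unfold chainEdges
        rw [← Set.range_comp]
        congr 1
        funext i
        refine Prod.ext (hey i) ?_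
        simp only [Function.comp_apply, Prod.map_apply]
        split_ifs
        · exact hey _
        · exact hen z hz
    refine (graphClass_eq_of_iso K l _ _ e (fun a b => ?_) fun v => ?_).symm
    · rw [← himg]
      exact ((e.injective.prodMap e.injective).mem_set_image (a := (a, b))).symm
    · by_cases hv : v ∈ Set.range y
      · obtain ⟨i, rfl⟩ := hv
        rw [hey, hx, hx]
      · rw [hen v hv]
  rw [hmain, Finset.sum_congr rfl fun σ _ => hiso σ, Finset.sum_const, Finset.card_univ,
    Fintype.card_perm, Fintype.card_fin, mul_smul, Nat.cast_smul_eq_nsmul]
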